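/- For a partition $\lambda$ of a non-negative integer $n$, let the least gap $g_1(\lambda)$ be the smallest positive integer that is not a part of $\lambda$ (so the empty partition of $0$ has least gap $1$), and let $S_1(n)=\sum_{\lambda\vdash n} g_1(\lambda)$ be the sum of the least gaps over all partitions of $n$. Then for every integer $n\ge 0$, $S_1(n)$ is odd if $n$ is twice a generalized pentagonal number, i.e. $n = 2\cdot\frac{k(3k-1)}{2}$ for some $k\in\mathbb{Z}$, and $S_1(n)$ is even otherwise. -/

import Mathlib

/-- For `r ≥ 1`, the least `r`-gap `g_r(lam)` of a partition `lam`: the smallest positive integer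
appearing fewer than `r` times as a part of `lam`. For `r = 1` this is the least gap, the smallest
positive integer that is not a part. (The set is nonempty if `1 ≤ r`, see `leastGap_isLeast`.) -/
noncomputable def leastGap (r : ℕ) {n : ℕ} (lam : n.Partition) : ℕ :=
  sInf {m : ℕ | 1 ≤ m ∧ lam.parts.count m < r}

/-- `S_r(n)`: the sum of the least `r`-gaps over all partitions of `n`. -/
noncomputable def sumLeastGaps (r n : ℕ) : ℕ :=
  ∑ lam : n.Partition, leastGap r lam

/-- For `r ≥ 1` the least `r`-gap is a genuine minimum. -/
theorem leastGap_isLeast {r : ℕ} (hr : 1 ≤ r) {n : ℕ} (lam : n.Partition) :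
    IsLeast {m : ℕ | 1 ≤ m ∧ lam.parts.count m < r} (leastGap r lam) := by
  have hne : {m : ℕ | 1 ≤ m ∧ lam.parts.count m < r}.Nonempty := by
    refine ⟨n + 1, by omega, ?_⟩
    have h : n + 1 ∉ lam.parts := fun hmem => by
      have := Nat.Partition.le_of_mem_parts hmem
      omega
    rw [Multiset.count_eq_zero_of_notMem h]
    omega
  exact ⟨Nat.sInf_mem hne, fun m hm => Nat.sInf_le hm⟩

open Finset Filter Topology PowerSeries
open scoped PowerSeries.WithPiTopology

/-! Write `E` for Euler's product and `P` for its inverse, the partition series. The least gap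
counts the `j ≥ 0` such that `1, …, j` are all parts; removing these parts gives `∑ S₁(n) qⁿ = P(q)
∑ q^(j(j+1)/2)`. By Gauss, the triangular sum is `E(q²)² / E(q)`, here as the limit of
`gauss_triangular_finite`. Modulo 2, `E(q²) = E(q)²`, so the series is `E⁴ / E² = E² = E(q²)`, and
the pentagonal number theorem gives its support. -/

/-- A polynomial identity behind Gauss's theorem on sums of triangular powers, due to Shanks. -/
theorem gauss_triangular_telescope {R : Type*} [CommRing R] (q : R) (n k : ℕ) (hk : k ≤ n) :
    ∑ s ∈ range (k + 1), (∏ r ∈ Ico s n, (1 - q ^ (2 * (r + 1)))) *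
        (∏ r ∈ range s, (1 - q ^ (2 * r + 1))) *
        (q ^ (s * (2 * n + 3)) * (1 - q ^ (2 * (n + 1))) -
          (1 - q ^ (2 * n + 1)) * q ^ (s * (2 * n + 1))) =
      (∏ r ∈ Ico k n, (1 - q ^ (2 * (r + 1)))) * (∏ r ∈ range (k + 1), (1 - q ^ (2 * r + 1))) *
        q ^ ((k + 1) * (2 * n + 1)) := by
  induction k with
  | zero => simp; ring
  | succ k ih =>
    rw [sum_range_succ, ih (by omega), prod_eq_prod_Ico_succ_bot (show k < n by omega),
      prod_range_succ _ (k + 1)]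
    ring

/-- Shanks's finite form of Gauss's theorem on sums of triangular powers. -/
theorem gauss_triangular_finite {R : Type*} [CommRing R] (q : R) (n : ℕ) :
    ∑ s ∈ range (n + 1), (∏ r ∈ Ico s n, (1 - q ^ (2 * (r + 1)))) *
        (∏ r ∈ range s, (1 - q ^ (2 * r + 1))) * q ^ (s * (2 * n + 1)) =
      (∏ r ∈ range n, (1 - q ^ (2 * r + 1))) *
        ∑ j ∈ range (2 * n + 1), q ^ (j * (j + 1) / 2) := by
  induction n with
  | zero => simp
  | succ n ih =>
    have h1 : (2 * n + 1) * (2 * n + 1 + 1) / 2 = (n + 1) * (2 * n + 1) :=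
      Nat.div_eq_of_eq_mul_left two_pos (by ring)
    have h2 : (2 * n + 1 + 1) * (2 * n + 1 + 1 + 1) / 2 = (n + 1) * (2 * n + 3) :=
      Nat.div_eq_of_eq_mul_left two_pos (by ring)
    -- At `k = n` this supplies the triangular term of index `2n + 1`; the last summand `s = n + 1`
    -- supplies that of index `2n + 2`.
    have ht := gauss_triangular_telescope q n n le_rfl
    simp only [mul_sub, sum_sub_distrib] at ht
    have hl : ∑ s ∈ range (n + 1), (∏ r ∈ Ico s (n + 1), (1 - q ^ (2 * (r + 1)))) *
        (∏ r ∈ range s, (1 - q ^ (2 * r + 1))) * q ^ (s * (2 * n + 3)) =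
        ∑ s ∈ range (n + 1), (∏ r ∈ Ico s n, (1 - q ^ (2 * (r + 1)))) *
        (∏ r ∈ range s, (1 - q ^ (2 * r + 1))) *
          (q ^ (s * (2 * n + 3)) * (1 - q ^ (2 * (n + 1)))) := by
      refine sum_congr rfl fun s hs => ?_
      rw [prod_Ico_succ_top (by grind)]
      ring
    have hr : ∑ s ∈ range (n + 1), (∏ r ∈ Ico s n, (1 - q ^ (2 * (r + 1)))) *
        (∏ r ∈ range s, (1 - q ^ (2 * r + 1))) *
          ((1 - q ^ (2 * n + 1)) * q ^ (s * (2 * n + 1))) =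
        (1 - q ^ (2 * n + 1)) * ∑ s ∈ range (n + 1), (∏ r ∈ Ico s n, (1 - q ^ (2 * (r + 1)))) *
        (∏ r ∈ range s, (1 - q ^ (2 * r + 1))) * q ^ (s * (2 * n + 1)) := by
      rw [mul_sum]
      exact sum_congr rfl fun s hs => by ring
    rw [hr, ih] at ht
    rw [sum_range_succ, show 2 * (n + 1) + 1 = 2 * n + 3 by ring, hl,
      show 2 * n + 3 = 2 * n + 1 + 1 + 1 by ring, sum_range_succ _ (2 * n + 1 + 1),
      sum_range_succ _ (2 * n + 1), h1, h2]
    simp only [mul_sub, Ico_self, prod_empty, one_mul, sum_sub_distrib] at ht ⊢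
    rw [sub_eq_iff_eq_add] at ht
    rw [show 2 * n + 1 + 1 + 1 = 2 * n + 3 by ring, ht, prod_range_succ]
    ring

theorem lt_leastGap_one_iff {n : ℕ} (p : n.Partition) (j : ℕ) :
    j < leastGap 1 p ↔ (Icc 1 j).val ≤ p.parts := by
  have h := leastGap_isLeast le_rfl p
  rw [Multiset.le_iff_subset (Icc 1 j).nodup]
  constructor
  · intro hj i hi
    by_contra hc
    have hi' : i ∈ Icc 1 j := hi
    rw [mem_Icc] at hi'
    have := h.2 ⟨hi'.1, by rw [Multiset.count_eq_zero_of_notMem hc]; exact one_pos⟩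
    omega
  · intro hs
    by_contra! hc
    have := Multiset.count_pos.2 (hs (show leastGap 1 p ∈ (Icc 1 j).val from
      mem_Icc.2 ⟨h.1.1, hc⟩))
    have := h.1.2
    omega

theorem leastGap_one_le {n : ℕ} (p : n.Partition) : leastGap 1 p ≤ n + 1 := by
  by_contra! hc
  have hle := (lt_leastGap_one_iff p (n + 1)).1 hc
  have hmem : n + 1 ∈ p.parts :=
    Multiset.mem_of_le hle (show n + 1 ∈ Icc 1 (n + 1) from mem_Icc.2 ⟨by omega, le_rfl⟩)
  have := Nat.Partition.le_of_mem_parts hmem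
  omega

theorem leastGap_one_eq_sum {n m : ℕ} (hm : n < m) (p : n.Partition) :
    leastGap 1 p = ∑ j ∈ range m, if (Icc 1 j).val ≤ p.parts then 1 else 0 := by
  simp_rw [← lt_leastGap_one_iff]
  rw [← card_filter]
  conv_lhs => rw [← card_range (leastGap 1 p)]
  congr 1
  ext j
  have := leastGap_one_le p
  simp only [mem_range, mem_filter]
  omega

/-- Removing a fixed multiset of positive integers from the partitions that contain it. -/
def Nat.Partition.containingEquiv {n m : ℕ} (s : Multiset ℕ) (hs : ∀ i ∈ s, 0 < i)
    (hsum : s.sum + m = n) : {p : n.Partition // s ≤ p.parts} ≃ m.Partition where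
  toFun p := ⟨p.1.parts - s, fun hi => p.1.parts_pos (Multiset.mem_of_le tsub_le_self hi), by
    have h := congrArg Multiset.sum (add_tsub_cancel_of_le p.2)
    rw [Multiset.sum_add, p.1.parts_sum] at h
    omega⟩
  invFun p := ⟨⟨s + p.parts, fun hi => (Multiset.mem_add.1 hi).elim (hs _) p.parts_pos, by
    rw [Multiset.sum_add, p.parts_sum, hsum]⟩, Multiset.le_add_right _ _⟩
  left_inv p := Subtype.ext <| Nat.Partition.ext <| add_tsub_cancel_of_le p.2
  right_inv p := Nat.Partition.ext <| add_tsub_cancel_left _ _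

theorem sum_Icc_one_val (j : ℕ) : (Icc 1 j).val.sum = j * (j + 1) / 2 := by
  refine (Nat.div_eq_of_eq_mul_left two_pos ?_).symm
  have h : ∑ i ∈ Icc 1 j, i = (Icc 1 j).val.sum := congrArg Multiset.sum (Multiset.map_id _)
  rw [← h]
  clear h
  induction j with
  | zero => rfl
  | succ j ih =>
    rw [sum_Icc_succ_top (by omega), add_mul (∑ k ∈ Icc 1 j, k), ← ih]
    ring

theorem card_partition_containing (n j : ℕ) :
    (∑ p : n.Partition, if (Icc 1 j).val ≤ p.parts then 1 else 0) =
      if j * (j + 1) / 2 ≤ n then Fintype.card (n - j * (j + 1) / 2).Partition else 0 := by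
  rw [← card_filter, ← Fintype.card_subtype, ← sum_Icc_one_val]
  split_ifs with h
  · exact Fintype.card_congr (Nat.Partition.containingEquiv _
      (fun i hi => (mem_Icc.1 (show i ∈ Icc 1 j from hi)).1) (by omega))
  · rw [Fintype.card_eq_zero_iff]
    refine ⟨fun p => h ?_⟩
    have := congrArg Multiset.sum (add_tsub_cancel_of_le p.2)
    rw [Multiset.sum_add, p.1.parts_sum] at this
    omega

theorem sumLeastGaps_one_eq_sum {n m : ℕ} (hm : n < m) :
    sumLeastGaps 1 n = ∑ j ∈ range m,
      if j * (j + 1) / 2 ≤ n then Fintype.card (n - j * (j + 1) / 2).Partition else 0 := by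
  simp_rw [sumLeastGaps, leastGap_one_eq_sum hm, ← card_partition_containing]
  exact sum_comm

section GeneratingFunctions

variable (R : Type*) [CommRing R]

/-- The generating function of the partition numbers is inverse to Euler's product. -/
theorem pentagonalSeries_mul_mk_card_partition :
    pentagonalSeries R * PowerSeries.mk (fun n => (Fintype.card n.Partition : R)) = 1 := by
  let _ : TopologicalSpace R := ⊥
  have _ : DiscreteTopology R := ⟨rfl⟩
  have h := Nat.Partition.hasProd_powerSeriesMk_card_restricted R (fun _ => True)
  have h' := (WithPiTopology.hasProd_one_sub_X_pow R).mul h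
  simp only [if_true, pow_mul] at h'
  -- Each Euler factor cancels its geometric series.
  simp_rw [WithPiTopology.one_sub_mul_tsum_pow_of_constantCoeff_eq_zero
    (show constantCoeff ((X : R⟦X⟧) ^ (_ + 1)) = 0 by simp)] at h'
  have := h'.unique hasProd_one
  simpa [Nat.Partition.restricted] using this

theorem tendsto_sum_triangular_mul_mk_card_partition [TopologicalSpace R] :
    Tendsto (fun m => (∑ j ∈ range m, (X : R⟦X⟧) ^ (j * (j + 1) / 2)) *
        PowerSeries.mk (fun n => (Fintype.card n.Partition : R))) atTop
      (𝓝 (PowerSeries.mk fun n => (sumLeastGaps 1 n : R))) := by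
  rw [WithPiTopology.tendsto_iff_coeff_tendsto]
  refine fun n => tendsto_atTop_of_eventually_const (i₀ := n + 1) fun m hm => ?_
  rw [sum_mul, map_sum, coeff_mk, sumLeastGaps_one_eq_sum hm, Nat.cast_sum]
  refine sum_congr rfl fun j _ => ?_
  rw [coeff_X_pow_mul']
  split_ifs <;> simp

/-- Disposes of the summands `s ≥ 1` in Shanks's sum, all divisible by `X ^ (2 * n + 1)`. -/
theorem tendsto_X_pow_mul_nhds_zero [TopologicalSpace R] (f : ℕ → R⟦X⟧) :
    Tendsto (fun n => X ^ (2 * n + 1) * f n) atTop (𝓝 0) := by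
  rw [WithPiTopology.tendsto_iff_coeff_tendsto]
  refine fun d => tendsto_atTop_of_eventually_const (i₀ := d) fun n hn => ?_
  rw [coeff_X_pow_mul', if_neg (by omega), map_zero]

end GeneratingFunctions

theorem prod_range_two_mul_eq {R : Type*} [CommRing R] (f : ℕ → R) (n : ℕ) :
    ∏ i ∈ range (2 * n), f i = (∏ r ∈ range n, f (2 * r)) * ∏ r ∈ range n, f (2 * r + 1) := by
  induction n with
  | zero => simp
  | succ n ih =>
    rw [show 2 * (n + 1) = 2 * n + 1 + 1 by ring, prod_range_succ, prod_range_succ, ih,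
      prod_range_succ, prod_range_succ]
    ring

theorem mk_sumLeastGaps_one_eq_sq :
    (PowerSeries.mk fun n => (sumLeastGaps 1 n : ZMod 2)) = pentagonalSeries (ZMod 2) ^ 2 := by
  have : CharP (ZMod 2)⟦X⟧ 2 := charP_of_injective_ringHom (C_injective (R := ZMod 2)) 2
  set E := pentagonalSeries (ZMod 2)
  set P := PowerSeries.mk (fun n => (Fintype.card n.Partition : ZMod 2))
  have hEP : E * P = 1 := pentagonalSeries_mul_mk_card_partition (ZMod 2)
  have hE : Tendsto (fun n => ∏ i ∈ range n, (1 - (X : (ZMod 2)⟦X⟧) ^ (i + 1))) atTop (𝓝 E) :=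
    (WithPiTopology.hasProd_one_sub_X_pow (ZMod 2)).tendsto_prod_nat
  have hEv : Tendsto (fun n => ∏ i ∈ range n, (1 - (X : (ZMod 2)⟦X⟧) ^ (2 * (i + 1)))) atTop
      (𝓝 (E ^ 2)) := by
    refine (hE.pow 2).congr fun n => ?_
    rw [← prod_pow]
    refine prod_congr rfl fun i _ => ?_
    rw [sub_pow_char, one_pow, ← pow_mul, mul_comm]
  have hG : Tendsto (fun n => ∑ s ∈ range (n + 1),
      (∏ r ∈ Ico s n, (1 - (X : (ZMod 2)⟦X⟧) ^ (2 * (r + 1)))) *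
        (∏ r ∈ range s, (1 - X ^ (2 * r + 1))) * X ^ (s * (2 * n + 1))) atTop (𝓝 (E ^ 2)) := by
    -- Only the summand `s = 0`, the product over even exponents, survives in the limit.
    have := hEv.add (tendsto_X_pow_mul_nhds_zero (ZMod 2) fun n => ∑ s ∈ range n,
      (∏ r ∈ Ico (s + 1) n, (1 - (X : (ZMod 2)⟦X⟧) ^ (2 * (r + 1)))) *
        (∏ r ∈ range (s + 1), (1 - X ^ (2 * r + 1))) * X ^ (s * (2 * n + 1)))
    rw [add_zero] at this
    refine this.congr fun n => ?_
    rw [sum_range_succ', add_comm, mul_sum]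
    congr 1
    · exact sum_congr rfl fun s _ => by ring
    · simp
  have h2 : Tendsto (fun n : ℕ => 2 * n) atTop atTop := tendsto_id.const_mul_atTop' two_pos
  -- The lengths `2n` and `2n + 1` match the finite identity multiplied by its even-exponent
  -- product.
  have hl := (hE.comp h2).mul ((tendsto_sum_triangular_mul_mk_card_partition (ZMod 2)).comp
    ((tendsto_add_atTop_nat 1).comp h2))
  have hr := (hEv.mul hG).mul_const P
  have key := tendsto_nhds_unique (hl.congr fun n => ?_) hr
  · have hE0 : E ≠ 0 := left_ne_zero_of_mul_eq_one hEP
    refine mul_left_cancel₀ hE0 (key.trans ?_)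
    linear_combination E ^ 3 * hEP
  · rw [gauss_triangular_finite]
    simp only [Function.comp_apply]
    rw [prod_range_two_mul_eq]
    simp only [mul_add, mul_one, add_assoc, one_add_one_eq_two, P]
    ring

/-- Frobenius fixes the coefficients in `ZMod 2`. -/
theorem expand_two_eq_sq (f : (ZMod 2)⟦X⟧) : PowerSeries.expand 2 two_ne_zero f = f ^ 2 := by
  have h := MvPowerSeries.map_frobenius_expand (σ := Unit) (R := ZMod 2) 2 two_ne_zero (f := f)
  rw [ZMod.frobenius_zmod, MvPowerSeries.map_id] at h
  exact h

theorem mainTheorem5 (n : ℕ) :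
    Odd (sumLeastGaps 1 n) ↔ ∃ k : ℤ, n = 2 * pentagonal k := by
  have h := congrArg (coeff n) mk_sumLeastGaps_one_eq_sq
  rw [← expand_two_eq_sq, coeff_mk, PowerSeries.coeff_expand] at h
  rw [← ZMod.natCast_ne_zero_iff_odd, h]
  split_ifs with h2
  · obtain ⟨m, rfl⟩ := h2
    rw [Nat.mul_div_cancel_left m two_pos, Ne, coeff_pentagonalSeries_eq_zero_iff, not_not]
    exact exists_congr fun k => by omega
  · simp only [ne_eq, not_true_eq_false, false_iff, not_exists]
    rintro k rfl
    exact h2 (dvd_mul_right _ _)
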